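/- Let $\Sigma$ be an alphabet (a set, possibly infinite). A factorization $T=f_1\cdots f_z$ of a string $T\in\Sigma^*$ into non-empty phrases is LZ-style if each $f_k$ is either a fresh character (a single character not occurring in $f_1\cdots f_{k-1}$) or a copy of a substring of $T$ that has an occurrence starting to the left of $f_k$. It is an LZ-End factorization if moreover each phrase $f_k$ that is not a fresh character is a suffix of $f_1\cdots f_h$ for some $1\le h<k$. Let $z_{\mathrm{End}}^{\mathrm{opt}}(T)$ be the least number $z$ of phrases of an LZ-End factorization of $T$. For an edit type $\mathrm{edit}\in\{\mathrm{sub},\mathrm{ins},\mathrm{del}\}$ and $n\ge 1$ let $$\mathrm{AS}_{\mathrm{edit}}^{\Sigma}(n)=\max\{z_{\mathrm{End}}^{\mathrm{opt}}(T')-z_{\mathrm{End}}^{\mathrm{opt}}(T)\;:\;T\in\Sigma^n,\ T'\in\Sigma^m,\ \mathrm{ed}(T,T')=1\},$$ where $\mathrm{ed}$ is the edit distance (least number of single-character substitutions, insertions and deletions turning one string into the other), and $m=n$ for $\mathrm{sub}$, $m=n+1$ for $\mathrm{ins}$, $m=n-1$ for $\mathrm{del}$; the maximum over the empty set is taken to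 be $0$. Theorem. (a) There is an absolute constant $C$ such that $\mathrm{AS}_{\mathrm{edit}}^{\Sigma}(n)\le C\,n^{2/3}$ for every alphabet $\Sigma$, every $\mathrm{edit}\in\{\mathrm{sub},\mathrm{ins},\mathrm{del}\}$ and every $n\ge 1$. (b) There are absolute constants $c>0$ and $N$ such that $\mathrm{AS}_{\mathrm{edit}}^{\Sigma}(n)\ge c\,n^{2/3}$ for every infinite alphabet $\Sigma$, every $\mathrm{edit}\in\{\mathrm{sub},\mathrm{ins},\mathrm{del}\}$ and every $n\ge N$. Hence, over an unbounded alphabet, the worst-case additive sensitivity of the optimal LZ-End factorization size is $\Theta(n^{2/3})$ for substitutions, insertions and deletions. -/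

import Mathlib

universe u

/-- The phrase number `k` (counted from `0`) of the sequence of phrases `fs` is a fresh character:
a single character that does not occur to its left. -/
def IsFreshPhrase {α : Type*} (fs : List (List α)) (k : ℕ) : Prop :=
  ∃ a : α, fs[k]? = some [a] ∧ a ∉ (fs.take k).flatten

/-- The phrase number `k` (counted from `0`) of `fs` is a copy of a substring occurring to its
left: it also occurs in `f_0 ⋯ f_k` at a position `i` (counted from `0`) smaller than its own
starting position `|f_0 ⋯ f_{k-1}|`. The two occurrences may overlap. -/
def IsCopiedPhrase {α : Type*} (fs : List (List α)) (k : ℕ) : Prop :=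
  ∃ f : List α, fs[k]? = some f ∧
    ∃ i : ℕ, i < (fs.take k).flatten.length ∧ f <+: (fs.take (k + 1)).flatten.drop i

/-- `fs` is an LZ-style factorization of the string `T`. -/
structure IsLZStyleFactorization {α : Type*} (T : List α) (fs : List (List α)) : Prop where
  flatten_eq : fs.flatten = T
  ne_nil : ∀ f ∈ fs, f ≠ []
  fresh_or_copied : ∀ k < fs.length, IsFreshPhrase fs k ∨ IsCopiedPhrase fs k

/-- `fs` is an LZ-End factorization of `T`: an LZ-style factorization in which each copied phrase
has an occurrence that ends where some previous phrase ends, that is, it is a suffix of the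
concatenation of the first `h` phrases, where `h ≥ 1` and these phrases all precede it. -/
structure IsLZEndFactorization {α : Type*} (T : List α) (fs : List (List α)) : Prop
    extends IsLZStyleFactorization T fs where
  source_ends : ∀ k f, fs[k]? = some f → ¬ IsFreshPhrase fs k →
    ∃ h : ℕ, 1 ≤ h ∧ h ≤ k ∧ f <:+ (fs.take h).flatten

/-- The size (number of phrases) of the optimal, i.e. smallest, LZ-End factorization of `T`. -/
noncomputable def lzEndOpt {α : Type*} (T : List α) : ℕ :=
  sInf {z : ℕ | ∃ fs : List (List α), IsLZEndFactorization T fs ∧ fs.length = z}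

/-- The three types of single-character edit operations. -/
inductive EditType where
  | sub
  | ins
  | del

/-- `m` is the length of a string obtained from a string of length `n` by an edit of the
given type. -/
def EditType.LengthRel : EditType → ℕ → ℕ → Prop
  | .sub, n, m => m = n
  | .ins, n, m => m = n + 1
  | .del, n, m => m + 1 = n

/-- `SingleEdit e S T`: the string `T` is obtained from `S` by one single-character edit operation
of type `e`. A substitution replaces a character by a different one. -/
inductive SingleEdit {α : Type*} : EditType → List α → List α → Prop where
  | sub (u v : List α) (a b : α) (hab : a ≠ b) : SingleEdit .sub (u ++ a :: v) (u ++ b :: v)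
  | ins (u v : List α) (b : α) : SingleEdit .ins (u ++ v) (u ++ b :: v)
  | del (u v : List α) (a : α) : SingleEdit .del (u ++ a :: v) (u ++ v)

/-- `EditPath k S T`: the string `S` can be turned into `T` by `k` single-character edits. -/
def EditPath {α : Type*} : ℕ → List α → List α → Prop
  | 0, S, T => S = T
  | k + 1, S, T => ∃ (e : EditType) (U : List α), SingleEdit e S U ∧ EditPath k U T

/-- The edit distance between two strings: the least number of single-character substitutions,
insertions and deletions that turn one into the other. -/
noncomputable def editDist {α : Type*} (S T : List α) : ℕ :=
  sInf {k : ℕ | EditPath k S T}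

/-- Strings at edit distance `1` whose lengths are related as prescribed by the type of the edit
are exactly those that arise by one edit of this type. -/
theorem editDist_eq_one_iff {α : Type*} (e : EditType) (S T : List α) :
    e.LengthRel S.length T.length ∧ editDist S T = 1 ↔ SingleEdit e S T := by
  constructor
  · rintro ⟨hl, h1⟩
    have hne : {k : ℕ | EditPath k S T}.Nonempty := Nat.nonempty_of_sInf_eq_succ h1
    have hm := Nat.sInf_mem hne
    have h1' : sInf {k : ℕ | EditPath k S T} = 1 := h1
    rw [h1'] at hm
    obtain ⟨e', U, hU, rfl⟩ := hm
    cases hU <;> cases e <;> simp [EditType.LengthRel] at hl <;>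
      first
        | (constructor; assumption)
        | constructor
        | omega
  · intro h
    have hl : e.LengthRel S.length T.length := by
      cases h <;> simp [EditType.LengthRel] <;> omega
    have hST : S ≠ T := by
      rintro rfl
      cases e with
      | sub =>
        generalize hT : S = T at h
        have hT' : SingleEdit .sub S T := by rw [← hT] at h ⊢; simpa using h
        clear h
        cases hT' with
        | sub u v a b hab => simp_all
      | ins => simp [EditType.LengthRel] at hl
      | del => simp [EditType.LengthRel] at hl
    refine ⟨hl, le_antisymm (Nat.sInf_le ⟨e, T, h, rfl⟩) ?_⟩
    rw [Nat.one_le_iff_ne_zero]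
    intro h0
    have hm := Nat.sInf_mem (s := {k : ℕ | EditPath k S T}) ⟨1, e, T, h, rfl⟩
    have h0' : sInf {k : ℕ | EditPath k S T} = 0 := h0
    rw [h0'] at hm
    exact hST hm

/-- The set of all differences `c(T') - c(T)`, where `T` has length `n`, `T'` is at edit distance
`1` from `T`, and the length of `T'` is the one prescribed by the type of the edit. -/
def sensitivitySet {α : Type*} (e : EditType) (c : List α → ℕ) (n : ℕ) : Set ℤ :=
  {d : ℤ | ∃ T T' : List α, T.length = n ∧ e.LengthRel n T'.length ∧ editDist T T' = 1 ∧
    d = (c T' : ℤ) - (c T : ℤ)}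

/-- The worst-case additive sensitivity of the measure `c` on strings of length `n` over `α`. -/
noncomputable def additiveSensitivity {α : Type*} (e : EditType) (c : List α → ℕ) (n : ℕ) : ℤ :=
  sSup (sensitivitySet e c n)

/-- The factorization into single characters is an LZ-End factorization, so that the infimum in
the definition of `lzEndOpt` is over a nonempty set. -/
theorem isLZEndFactorization_singletons {α : Type*} (T : List α) :
    IsLZEndFactorization T (T.map fun a => [a]) := by
  have hfl : ∀ l : List α, (l.map fun a => [a]).flatten = l := by
    intro l; induction l with
    | nil => rfl
    | cons a l ih => simp [ih]
  have key : ∀ k a, T[k]? = some a → a ∈ T.take k →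
      ∃ j < k, [a] <:+ T.take (j + 1) := by
    intro k a _ ha
    obtain ⟨j, hj, hja⟩ := List.getElem_of_mem ha
    have hj' : j < k ∧ j < T.length := by simpa using hj
    refine ⟨j, hj'.1, T.take j, ?_⟩
    rw [List.take_add_one, List.getElem?_eq_getElem hj'.2]
    simp at hja
    simp [hja]
  refine ⟨⟨hfl T, by simp, ?_⟩, ?_⟩
  · intro k hk
    have hk' : k < T.length := by simpa using hk
    by_cases ha : T[k] ∈ T.take k
    · right
      obtain ⟨j, hj, t, ht⟩ := key k T[k] (List.getElem?_eq_getElem hk') ha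
      have hjl : j + 1 ≤ T.length := by omega
      have htl : t.length = j := by
        have := congrArg List.length ht
        simp at this; omega
      refine ⟨[T[k]], by simp [List.getElem?_eq_getElem hk'], j, ?_, ?_⟩
      · rw [← List.map_take, hfl, List.length_take]; omega
      · rw [← List.map_take, hfl]
        have h1 : T.take (j + 1) <+: T.take (k + 1) :=
          List.take_prefix_take_left (by omega)
        obtain ⟨s, hs⟩ := h1
        refine ⟨s, ?_⟩
        rw [← hs, ← ht, List.append_assoc, ← htl, List.drop_left]
    · left
      refine ⟨T[k], by simp [List.getElem?_eq_getElem hk'], ?_⟩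
      rwa [← List.map_take, hfl]
  · intro k f hf hnf
    rw [List.getElem?_map, Option.map_eq_some_iff] at hf
    obtain ⟨a, hka, rfl⟩ := hf
    have ha : a ∈ T.take k := by
      by_contra h
      exact hnf ⟨a, by simp [hka], by rwa [← List.map_take, hfl]⟩
    obtain ⟨j, hj, hs⟩ := key k a hka ha
    exact ⟨j + 1, by omega, by omega, by rwa [← List.map_take, hfl]⟩

theorem lzEndOpt_le_length {α : Type*} (T : List α) : lzEndOpt T ≤ T.length :=
  Nat.sInf_le ⟨_, isLZEndFactorization_singletons T, by simp⟩

/-- The additive sensitivity of `lzEndOpt` is a maximum, as soon as there is a string to edit. -/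
theorem isGreatest_additiveSensitivity {α : Type*} (e : EditType) (n : ℕ)
    (hne : (sensitivitySet e (lzEndOpt (α := α)) n).Nonempty) :
    IsGreatest (sensitivitySet e (lzEndOpt (α := α)) n)
      (additiveSensitivity e (lzEndOpt (α := α)) n) := by
  have hb : BddAbove (sensitivitySet e (lzEndOpt (α := α)) n) := by
    refine ⟨(n : ℤ) + 1, ?_⟩
    rintro d ⟨T, T', -, hm, -, rfl⟩
    have h := lzEndOpt_le_length T'
    have h' : T'.length ≤ n + 1 := by
      cases e <;> simp only [EditType.LengthRel] at hm <;> omega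
    omega
  exact ⟨Int.csSup_mem hne hb, fun d hd => le_csSup hb hd⟩

/-!
For the upper bound, let `n ≤ L ^ 3` and take an optimal factorization of the old string
`A ++ x ++ B`, where `x` is the edited character (or empty). Cutting the phrase around `x` makes `x`
a phrase at the cost of `r` additional ones with `r * (r - 1) / 2 ≤ n`. When `x` is then replaced
by `y`, a later phrase loses its source only if that source covers `x`, so the phrase is
`u ++ x ++ R` with `u` a suffix of `A` and `R` a prefix of `B`. It is cut into `u`, `x` and `R`, and
further phrases with the same `u` and `R` copy this occurrence instead. A pair `(u, R)` is
determined by its two lengths: at most `L ^ 2` pairs have both lengths below `L`, and the others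
take up at least `L` characters of `B` each, so that there are at most `n / L ≤ L ^ 2` of them.

For the lower bound, a central word with pairwise different characters is followed by `m ^ 2`
blocks, separated by fresh characters. They are the factors of the central word that start at most
`m` characters before the edited position and end at most `m` characters after it, in such an order
that none contains a later one. Before the edit every block is copied from the central word. After
the edit it occurs neither there nor in the previous blocks and needs at least two phrases. Thus
the edit costs about `m ^ 2` phrases, while the length of the string is of order `m ^ 3`.
-/

variable {α β : Type*}

section Parsing

variable {F G H K : List (List α)} {f P T : List α}

/-- The concatenations of the first phrases of `F`, that is, the prefixes of `F.flatten` that end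
at a phrase boundary. -/
def boundaryPrefixes (F : List (List α)) : Set (List α) :=
  List.flatten '' {H | H <+: F}

/-- `f` can follow the phrases `F`: it has at most one character or a source ending at a boundary
of `F`. The empty phrase is allowed, so that cutting a phrase into two needs no case distinction. -/
def IsEndPhrase (F : List (List α)) (f : List α) : Prop :=
  f.length ≤ 1 ∨ ∃ P ∈ boundaryPrefixes F, f <:+ P

/-- Every phrase can follow the phrases before it. Up to empty phrases, these are the LZ-End
factorizations. -/
def IsEndParsing (F : List (List α)) : Prop :=
  ∀ G f, G ++ [f] <+: F → IsEndPhrase G f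

theorem boundaryPrefixes_mono (h : G <+: F) : boundaryPrefixes G ⊆ boundaryPrefixes F :=
  Set.image_mono fun _ hH => hH.trans h

theorem flatten_mem_boundaryPrefixes (h : G <+: F) : G.flatten ∈ boundaryPrefixes F :=
  ⟨G, h, rfl⟩

theorem prefix_flatten_of_mem_boundaryPrefixes (h : P ∈ boundaryPrefixes F) : P <+: F.flatten := by
  obtain ⟨H, ⟨K, rfl⟩, rfl⟩ := h
  exact ⟨K.flatten, List.flatten_append.symm⟩

theorem mem_boundaryPrefixes_concat :
    P ∈ boundaryPrefixes (F ++ [f]) ↔ P ∈ boundaryPrefixes F ∨ P = F.flatten ++ f := by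
  constructor
  · rintro ⟨H, hH, rfl⟩
    rcases List.prefix_concat_iff.1 hH with rfl | hH
    · exact .inr List.flatten_concat
    · exact .inl ⟨H, hH, rfl⟩
  · rintro (h | rfl)
    · exact boundaryPrefixes_mono (List.prefix_append F [f]) h
    · exact ⟨F ++ [f], List.prefix_rfl, List.flatten_concat⟩

theorem isEndPhrase_of_length_le_one (h : f.length ≤ 1) : IsEndPhrase F f :=
  .inl h

theorem IsEndPhrase.mono (h : IsEndPhrase G f) (hG : boundaryPrefixes G ⊆ boundaryPrefixes F) :
    IsEndPhrase F f :=
  h.imp_right fun ⟨P, hP, hf⟩ => ⟨P, hG hP, hf⟩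

theorem IsEndPhrase.append (h : IsEndPhrase F f) (G : List (List α)) : IsEndPhrase (F ++ G) f :=
  h.mono (boundaryPrefixes_mono (List.prefix_append F G))

theorem IsEndPhrase.of_suffix {g : List α} (hf : IsEndPhrase F f) (h : g <:+ f) :
    IsEndPhrase F g :=
  hf.imp h.length_le.trans fun ⟨P, hP, hfP⟩ => ⟨P, hP, h.trans hfP⟩

theorem IsEndParsing.of_prefix (hF : IsEndParsing F) (h : G <+: F) : IsEndParsing G :=
  fun H f hH => hF H f (hH.trans h)

theorem isEndParsing_nil : IsEndParsing ([] : List (List α)) :=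
  fun G f h => absurd h (by simp)

theorem isEndParsing_concat_iff :
    IsEndParsing (F ++ [f]) ↔ IsEndParsing F ∧ IsEndPhrase F f := by
  constructor
  · intro h
    exact ⟨h.of_prefix (List.prefix_append F [f]), h F f List.prefix_rfl⟩
  · rintro ⟨hF, hf⟩ G g hG
    rcases List.prefix_concat_iff.1 hG with h | h
    · obtain ⟨rfl, rfl⟩ := List.append_singleton_inj.1 h
      exact hf
    · exact hF G g h

theorem IsEndParsing.append (hF : IsEndParsing F) (hG : ∀ g ∈ G, IsEndPhrase F g) :
    IsEndParsing (F ++ G) := by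
  induction G using List.reverseRecOn with
  | nil => rwa [List.append_nil]
  | append_singleton G g ih =>
    rw [← List.append_assoc, isEndParsing_concat_iff]
    exact ⟨ih fun h hh => hG h (List.mem_append_left _ hh), (hG g (by simp)).append G⟩

theorem flatten_map_singleton (T : List α) : (T.map fun a => [a]).flatten = T := by
  rw [← List.flatMap_def, List.flatMap_singleton']

theorem IsEndParsing.append_map_singleton (hF : IsEndParsing F) (T : List α) :
    IsEndParsing (F ++ T.map fun a => [a]) :=
  hF.append (by simp [IsEndPhrase])

theorem IsEndParsing.filter_not_isEmpty (hF : IsEndParsing F) :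
    IsEndParsing (F.filter fun f => !f.isEmpty) := by
  induction F using List.reverseRecOn with
  | nil => exact isEndParsing_nil
  | append_singleton F f ih =>
    obtain ⟨hF, hf⟩ := isEndParsing_concat_iff.1 hF
    rw [List.filter_append]
    refine (ih hF).append fun g hg => ?_
    obtain rfl : g = f := List.mem_singleton.1 (List.mem_of_mem_filter hg)
    refine hf.mono ?_
    rintro _ ⟨H, hH, rfl⟩
    exact ⟨H.filter fun f => !f.isEmpty, hH.filter _, List.flatten_filter_not_isEmpty⟩

/-- Cutting a phrase into pieces only adds boundaries, so all later sources remain available. -/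
theorem IsEndParsing.refine (hF : IsEndParsing (G ++ f :: K)) (hH : ∀ h ∈ H, IsEndPhrase G h)
    (hHf : H.flatten = f) : IsEndParsing (G ++ H ++ K) := by
  induction K using List.reverseRecOn with
  | nil =>
    rw [List.append_nil]
    exact (isEndParsing_concat_iff.1 hF).1.append hH
  | append_singleton K k ih =>
    rw [← List.cons_append, ← List.append_assoc, isEndParsing_concat_iff] at hF
    rw [← List.append_assoc, isEndParsing_concat_iff]
    refine ⟨ih hF.1, hF.2.mono ?_⟩
    rintro _ ⟨L, hL, rfl⟩
    rcases List.prefix_or_prefix_of_prefix hL (List.prefix_append G (f :: K)) with h | ⟨M, rfl⟩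
    · exact flatten_mem_boundaryPrefixes (h.trans ⟨H ++ K, by simp⟩)
    · rcases List.prefix_cons_iff.1 ((List.prefix_append_right_inj G).1 hL) with rfl | ⟨M, rfl, hM⟩
      · exact ⟨G, ⟨H ++ K, by simp⟩, by simp⟩
      · exact ⟨G ++ H ++ M, (List.prefix_append_right_inj _).2 hM, by simp [hHf]⟩

theorem exists_eq_append_cons_of_flatten_eq {X Y : List α} {c : α}
    (h : F.flatten = X ++ c :: Y) :
    ∃ G u v K, F = G ++ (u ++ c :: v) :: K ∧ X = G.flatten ++ u ∧ Y = v ++ K.flatten := by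
  rcases List.flatten_eq_append_iff.1 h with ⟨G, K, rfl, rfl, hK⟩ | ⟨G, u, b, v, K, rfl, rfl, hK⟩
  · obtain ⟨N, v, K, rfl, hN, rfl⟩ := List.flatten_eq_cons_iff.1 hK.symm
    exact ⟨G ++ N, [], v, K, by simp, by simp [List.flatten_eq_nil_iff.2 hN], rfl⟩
  · obtain ⟨rfl, rfl⟩ := List.cons_eq_cons.1 hK
    exact ⟨G, u, v, K, rfl, rfl, rfl⟩

theorem IsEndParsing.exists_eq_append_singleton_cons (hF : IsEndParsing F) {X Y : List α} {c : α}
    (h : F.flatten = X ++ c :: Y) (hc : c ∉ X) :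
    ∃ G K, F = G ++ [c] :: K ∧ G.flatten = X ∧ K.flatten = Y := by
  obtain ⟨G, u, v, K, rfl, rfl, rfl⟩ := exists_eq_append_cons_of_flatten_eq h
  rcases hF G (u ++ c :: v) ⟨K, by simp⟩ with h1 | ⟨P, hP, hs⟩
  · obtain ⟨rfl, rfl⟩ : u = [] ∧ v = [] := by
      simp only [List.length_append, List.length_cons] at h1
      exact ⟨List.eq_nil_of_length_eq_zero (by omega), List.eq_nil_of_length_eq_zero (by omega)⟩
    exact ⟨G, K, by simp⟩
  · have hcP : c ∈ P := hs.subset (by simp)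
    have hcG : c ∈ G.flatten := (prefix_flatten_of_mem_boundaryPrefixes hP).subset hcP
    exact absurd (List.mem_append_left u hcG) hc

theorem IsEndParsing.exists_singleton_suffix_of_mem (hF : IsEndParsing F) {a : α}
    (ha : a ∈ F.flatten) : ∃ P ∈ boundaryPrefixes F, [a] <:+ P := by
  obtain ⟨X, Y, hXY, haX⟩ := List.eq_append_cons_of_mem ha
  obtain ⟨G, K, rfl, -, -⟩ := hF.exists_eq_append_singleton_cons hXY haX
  exact ⟨(G ++ [[a]]).flatten, flatten_mem_boundaryPrefixes ⟨K, by simp⟩, G.flatten, by simp⟩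

theorem take_append_singleton_prefix {k : ℕ} (h : F[k]? = some f) : F.take k ++ [f] <+: F := by
  have : F.take (k + 1) = F.take k ++ [f] := by rw [List.take_add_one, h]; rfl
  exact this ▸ List.take_prefix _ _

theorem IsLZEndFactorization.isEndParsing (h : IsLZEndFactorization T F) : IsEndParsing F := by
  rintro G f ⟨K, rfl⟩
  have hk : (G ++ [f] ++ K)[G.length]? = some f := by simp
  by_cases hfresh : IsFreshPhrase (G ++ [f] ++ K) G.length
  · obtain ⟨a, ha, -⟩ := hfresh
    obtain rfl : f = [a] := Option.some.inj (hk.symm.trans ha)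
    exact isEndPhrase_of_length_le_one le_rfl
  · obtain ⟨i, -, hi, hs⟩ := h.source_ends _ f hk hfresh
    rw [List.append_assoc, List.take_append_of_le_length hi] at hs
    exact .inr ⟨_, flatten_mem_boundaryPrefixes (List.take_prefix i G), hs⟩

theorem IsEndParsing.exists_source (hF : IsEndParsing F) {k : ℕ} (hk : F[k]? = some f)
    (hne : f ≠ []) (hfresh : ¬ IsFreshPhrase F k) :
    ∃ h : ℕ, 1 ≤ h ∧ h ≤ k ∧ f <:+ (F.take h).flatten := by
  obtain ⟨_, ⟨H, hH, rfl⟩, hs⟩ : ∃ P ∈ boundaryPrefixes (F.take k), f <:+ P := by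
    rcases hF _ _ (take_append_singleton_prefix hk) with h1 | hsource
    · obtain ⟨a, rfl⟩ := List.length_eq_one_iff.1 (h1.antisymm (List.length_pos_iff.2 hne))
      have ha : a ∈ (F.take k).flatten := by
        by_contra ha
        exact hfresh ⟨a, hk, ha⟩
      exact (hF.of_prefix (List.take_prefix k F)).exists_singleton_suffix_of_mem ha
    · exact hsource
  refine ⟨H.length, ?_, hH.length_le.trans (List.length_take_le k F), ?_⟩
  · refine List.length_pos_iff.2 ?_
    rintro rfl
    exact hne (List.suffix_nil.1 hs)
  · rwa [← List.prefix_iff_eq_take.1 (hH.trans (List.take_prefix k F))]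

theorem isCopiedPhrase_of_suffix {h k : ℕ} (hk : F[k]? = some f) (hne : f ≠ []) (hhk : h ≤ k)
    (hs : f <:+ (F.take h).flatten) : IsCopiedPhrase F k := by
  obtain ⟨t, ht⟩ := hs
  have hpre : ∀ {n}, h ≤ n → (F.take h).flatten <+: (F.take n).flatten := fun hn =>
    prefix_flatten_of_mem_boundaryPrefixes
      (flatten_mem_boundaryPrefixes (List.take_prefix_take_left hn))
  refine ⟨f, hk, t.length, ?_, ?_⟩
  · calc t.length < (t ++ f).length := by
          rw [List.length_append]
          exact Nat.lt_add_of_pos_right (List.length_pos_iff.2 hne)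
      _ = (F.take h).flatten.length := by rw [ht]
      _ ≤ (F.take k).flatten.length := (hpre hhk).length_le
  · obtain ⟨s, hs⟩ := hpre (hhk.trans k.le_succ)
    exact ⟨s, by rw [← hs, ← ht, List.append_assoc, List.drop_left]⟩

theorem IsEndParsing.isLZEndFactorization (hF : IsEndParsing F) (hne : ∀ f ∈ F, f ≠ []) :
    IsLZEndFactorization F.flatten F where
  flatten_eq := rfl
  ne_nil := hne
  fresh_or_copied k hk := by
    refine or_iff_not_imp_left.2 fun hfresh => ?_
    have hk' := List.getElem?_eq_getElem hk
    have hne' := hne _ (List.getElem_mem hk)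
    obtain ⟨h, -, hhk, hs⟩ := hF.exists_source hk' hne' hfresh
    exact isCopiedPhrase_of_suffix hk' hne' hhk hs
  source_ends k f hk hfresh := hF.exists_source hk (hne f (List.mem_of_getElem? hk)) hfresh

theorem IsEndParsing.lzEndOpt_le (hF : IsEndParsing F) : lzEndOpt F.flatten ≤ F.length := by
  have hfilter := hF.filter_not_isEmpty.isLZEndFactorization (by simp)
  rw [List.flatten_filter_not_isEmpty] at hfilter
  have hle : lzEndOpt F.flatten ≤ (F.filter fun f => !f.isEmpty).length :=
    Nat.sInf_le ⟨_, hfilter, rfl⟩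
  exact hle.trans (List.length_filter_le _ F)

theorem exists_isEndParsing_length_eq_lzEndOpt (T : List α) :
    ∃ F, IsEndParsing F ∧ F.flatten = T ∧ F.length = lzEndOpt T := by
  obtain ⟨F, hF, hlen⟩ : lzEndOpt T ∈ {z | ∃ F, IsLZEndFactorization T F ∧ F.length = z} :=
    Nat.sInf_mem ⟨_, _, isLZEndFactorization_singletons T, rfl⟩
  exact ⟨F, hF.isEndParsing, hF.flatten_eq, hlen⟩

theorem lzEndOpt_append_le_add_length (X Z : List α) :
    lzEndOpt (X ++ Z) ≤ lzEndOpt X + Z.length := by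
  obtain ⟨F, hF, rfl, hlen⟩ := exists_isEndParsing_length_eq_lzEndOpt X
  simpa [flatten_map_singleton, hlen] using (hF.append_map_singleton Z).lzEndOpt_le

theorem IsEndParsing.map (hF : IsEndParsing F) (g : α → β) : IsEndParsing (F.map (List.map g)) := by
  induction F using List.reverseRecOn with
  | nil => exact isEndParsing_nil
  | append_singleton F f ih =>
    obtain ⟨hF, hf⟩ := isEndParsing_concat_iff.1 hF
    rw [List.map_append, List.map_singleton, isEndParsing_concat_iff]
    refine ⟨ih hF, hf.imp (by simp) ?_⟩
    rintro ⟨_, ⟨H, hH, rfl⟩, hs⟩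
    exact ⟨_, flatten_mem_boundaryPrefixes (hH.map _), by simpa [List.map_flatten] using hs.map g⟩

theorem lzEndOpt_map_le (g : α → β) (T : List α) : lzEndOpt (T.map g) ≤ lzEndOpt T := by
  obtain ⟨F, hF, rfl, hlen⟩ := exists_isEndParsing_length_eq_lzEndOpt T
  rw [← hlen, ← List.length_map (List.map g), List.map_flatten]
  exact (hF.map g).lzEndOpt_le

theorem lzEndOpt_map_of_injective {g : α → β} (hg : Function.Injective g) (T : List α) :
    lzEndOpt (T.map g) = lzEndOpt T := by
  refine (lzEndOpt_map_le g T).antisymm ?_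
  rcases T with - | ⟨a, T⟩
  · exact (lzEndOpt_le_length []).trans (Nat.zero_le _)
  · have : Nonempty α := ⟨a⟩
    have h := lzEndOpt_map_le (Function.invFun g) ((a :: T).map g)
    rwa [List.map_map, Function.invFun_comp hg, List.map_id] at h

end Parsing

section Cover

variable {F G : List (List α)} {A B P X R u v x : List α}

theorem prefix_append_iff_or (X R : List α) :
    P <+: X ++ R ↔ P <+: X ∨ ∃ s, s <+: R ∧ P = X ++ s := by
  constructor
  · intro h
    rcases List.prefix_or_prefix_of_prefix h (List.prefix_append X R) with hP | ⟨s, rfl⟩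
    · exact .inl hP
    · exact .inr ⟨s, (List.prefix_append_right_inj X).1 h, rfl⟩
  · rintro (h | ⟨s, h, rfl⟩)
    · exact h.trans (List.prefix_append X R)
    · exact (List.prefix_append_right_inj X).2 h

theorem suffix_append_iff_or (X R : List α) :
    P <:+ X ++ R ↔ P <:+ R ∨ ∃ s, s <:+ X ∧ P = s ++ R := by
  constructor
  · intro h
    rcases List.suffix_or_suffix_of_suffix h (List.suffix_append X R) with hP | ⟨s, rfl⟩
    · exact .inl hP
    · exact .inr ⟨s, ((List.suffix_append_inj_of_length_eq rfl).1 h).1, rfl⟩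
  · rintro (h | ⟨s, ⟨t, rfl⟩, rfl⟩)
    · exact h.trans (List.suffix_append X R)
    · exact ⟨t, by simp⟩

/-- `Gs` cuts `u` into phrases that can follow `F`, with no more phrases than characters. -/
structure IsCover (F : List (List α)) (u : List α) (Gs : List (List α)) : Prop where
  flatten_eq : Gs.flatten = u
  isEndPhrase : ∀ g ∈ Gs, IsEndPhrase F g
  length_le : Gs.length ≤ u.length

theorem IsCover.append {Gs : List (List α)} (h : IsCover F u Gs) (G : List (List α)) :
    IsCover (F ++ G) u Gs where
  flatten_eq := h.flatten_eq
  isEndPhrase g hg := (h.isEndPhrase g hg).append G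
  length_le := h.length_le

theorem isCover_map_singleton (F : List (List α)) (u : List α) :
    IsCover F u (u.map fun a => [a]) where
  flatten_eq := flatten_map_singleton u
  isEndPhrase := by simp [IsEndPhrase]
  length_le := by simp

theorem IsEndPhrase.exists_isCover {s : List α} (hf : IsEndPhrase F (u ++ v)) (hs : s <:+ u)
    (hcover : ∀ {P u}, P <+: F.flatten → u <:+ P →
      ∃ Gs, IsCover F u Gs ∧ Gs.length.choose 2 ≤ P.length) :
    ∃ Gs, IsCover F s Gs ∧ Gs.length.choose 2 ≤ F.flatten.length := by
  rcases hf with h1 | ⟨Q, hQ, t, rfl⟩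
  · have hs1 : s.length ≤ 1 :=
      (hs.length_le.trans (List.prefix_append u v).length_le).trans h1
    refine ⟨_, isCover_map_singleton F s, ?_⟩
    rw [List.length_map, Nat.choose_eq_zero_of_lt (by omega)]
    exact Nat.zero_le _
  · have hP : t ++ u <+: F.flatten :=
      .trans ⟨v, by simp⟩ (prefix_flatten_of_mem_boundaryPrefixes hQ)
    obtain ⟨Gs, hGs, hle⟩ := hcover hP (hs.trans (List.suffix_append t u))
    exact ⟨Gs, hGs, hle.trans hP.length_le⟩

/-- If `P` ends inside a phrase `f = u' ++ v` of `F` and `u = w ++ u'`, then `w` is a single phrase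
and `u'` is covered by `r ≤ |u'|` phrases found to the left of `f`; the bound is preserved because
`(r + 1).choose 2 = r + r.choose 2`. -/
theorem IsEndParsing.exists_isCover (hF : IsEndParsing F) (hP : P <+: F.flatten) (hu : u <:+ P) :
    ∃ Gs, IsCover F u Gs ∧ Gs.length.choose 2 ≤ P.length := by
  induction F using List.reverseRecOn generalizing P u with
  | nil =>
    obtain rfl := List.prefix_nil.1 hP
    obtain rfl := List.suffix_nil.1 hu
    exact ⟨_, isCover_map_singleton [] [], le_rfl⟩
  | append_singleton F f ih =>
    obtain ⟨hF', hf⟩ := isEndParsing_concat_iff.1 hF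
    rw [List.flatten_concat, prefix_append_iff_or] at hP
    rcases hP with hP | ⟨u', ⟨v, rfl⟩, rfl⟩
    · obtain ⟨Gs, hGs, hle⟩ := ih hF' hP hu
      exact ⟨Gs, hGs.append _, hle⟩
    rcases (suffix_append_iff_or _ _).1 hu with hu | ⟨w, hw, rfl⟩
    · obtain ⟨Gs, hGs, hle⟩ := hf.exists_isCover hu (ih hF')
      exact ⟨Gs, hGs.append _, hle.trans (List.prefix_append _ _).length_le⟩
    obtain ⟨Gs, hGs, hle⟩ := hf.exists_isCover List.suffix_rfl (ih hF')
    rcases eq_or_ne w [] with rfl | hne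
    · exact ⟨Gs, hGs.append _, hle.trans (List.prefix_append _ _).length_le⟩
    have hw' : IsEndPhrase F w := .inr ⟨_, flatten_mem_boundaryPrefixes List.prefix_rfl, hw⟩
    have hpos := List.length_pos_iff.2 hne
    refine ⟨w :: Gs, IsCover.append ⟨by simp [hGs.flatten_eq], ?_, ?_⟩ _, ?_⟩
    · exact List.forall_mem_cons.2 ⟨hw', hGs.isEndPhrase⟩
    · have := hGs.length_le
      simp only [List.length_cons, List.length_append]
      omega
    · calc (w :: Gs).length.choose 2 = Gs.length + Gs.length.choose 2 := by
            rw [List.length_cons, Nat.choose_succ_succ, Nat.choose_one_right]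
        _ ≤ u'.length + F.flatten.length := add_le_add hGs.length_le hle
        _ = (F.flatten ++ u').length := by rw [List.length_append, add_comm]

theorem exists_eq_append_cons_of_flatten_eq_of_length_le_one (hx : x.length ≤ 1)
    (hne : x ++ B ≠ []) (h : F.flatten = A ++ x ++ B) :
    ∃ G u w K, F = G ++ (u ++ x ++ w) :: K ∧ A = G.flatten ++ u ∧ B = w ++ K.flatten := by
  obtain ⟨c, Y, hcY⟩ := List.exists_cons_of_ne_nil hne
  rw [List.append_assoc, hcY] at h
  obtain ⟨G, u, v, K, rfl, rfl, rfl⟩ := exists_eq_append_cons_of_flatten_eq h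
  match x, hx with
  | [], _ => exact ⟨G, u, c :: v, K, by simp, rfl, hcY⟩
  | [b], _ =>
    obtain ⟨rfl, rfl⟩ := List.cons_eq_cons.1 hcY
    exact ⟨G, u, v, K, by simp, rfl, rfl⟩

theorem IsEndParsing.exists_isolate (hF : IsEndParsing F) (hx : x.length ≤ 1)
    (h : F.flatten = A ++ x ++ B) :
    ∃ J K r, IsEndParsing (J ++ x :: K) ∧ J.flatten = A ∧ K.flatten = B ∧
      r.choose 2 ≤ A.length ∧ (J ++ x :: K).length ≤ F.length + r + 1 := by
  by_cases hne : x ++ B = []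
  · obtain ⟨rfl, rfl⟩ := List.append_eq_nil_iff.1 hne
    exact ⟨F, [], 0, isEndParsing_concat_iff.2 ⟨hF, isEndPhrase_of_length_le_one hx⟩,
      by simpa using h, rfl, by simp, by simp⟩
  obtain ⟨G, u, w, K, rfl, rfl, rfl⟩ :=
    exists_eq_append_cons_of_flatten_eq_of_length_le_one hx hne h
  have hG := isEndParsing_concat_iff.1 (hF.of_prefix (G := G ++ [u ++ x ++ w]) ⟨K, by simp⟩)
  have hf : IsEndPhrase G (u ++ (x ++ w)) := by simpa using hG.2
  obtain ⟨Gs, hGs, hle⟩ := hf.exists_isCover List.suffix_rfl hG.1.exists_isCover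
  have hpieces : ∀ g ∈ Gs ++ [x, w], IsEndPhrase G g := by
    simp only [List.forall_mem_append, List.forall_mem_cons]
    exact ⟨hGs.isEndPhrase, isEndPhrase_of_length_le_one hx, hf.of_suffix ⟨u ++ x, by simp⟩,
      by simp⟩
  refine ⟨G ++ Gs, w :: K, Gs.length, ?_, by simp [hGs.flatten_eq], by simp,
    hle.trans (by simp), by simp; omega⟩
  simpa using hF.refine hpieces (by simp [hGs.flatten_eq])

end Cover

section Edit

variable {A B R f s w x y : List α} {J G H K : List (List α)} {D : Finset (List α × List α)}

/-- `J` parses `A ++ x ++ w`, `G` parses `A ++ y ++ w`, and the boundaries of `J` that are not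
inside `x` are also boundaries of `G`. Moreover `G` has a boundary just before `y`. -/
structure TransfersBoundaries (A x y w : List α) (J G : List (List α)) : Prop where
  flatten_old : J.flatten = A ++ x ++ w
  flatten_new : G.flatten = A ++ y ++ w
  mem_edit : A ∈ boundaryPrefixes G
  mem_left : ∀ P ∈ boundaryPrefixes J, P <+: A → P ∈ boundaryPrefixes G
  mem_right : ∀ R, A ++ x ++ R ∈ boundaryPrefixes J → A ++ y ++ R ∈ boundaryPrefixes G

theorem transfersBoundaries_concat_edit (hJ : J.flatten = A) (x y : List α) :
    TransfersBoundaries A x y [] (J ++ [x]) (J ++ [y]) where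
  flatten_old := by simp [hJ]
  flatten_new := by simp [hJ]
  mem_edit := hJ ▸ flatten_mem_boundaryPrefixes (List.prefix_append J [y])
  mem_left P hP hPA := by
    refine mem_boundaryPrefixes_concat.2 (.inl ?_)
    rcases mem_boundaryPrefixes_concat.1 hP with hP | rfl
    · exact hP
    · rw [hPA.eq_of_length_le (by simp [hJ]), ← hJ]
      exact flatten_mem_boundaryPrefixes List.prefix_rfl
  mem_right R hR := by
    obtain rfl : R = [] := by
      have := (prefix_flatten_of_mem_boundaryPrefixes hR).length_le
      simpa [hJ] using this
    exact mem_boundaryPrefixes_concat.2 (.inr (by simp [hJ]))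

theorem TransfersBoundaries.concat (h : TransfersBoundaries A x y w J G) (hH : H.flatten = f) :
    TransfersBoundaries A x y (w ++ f) (J ++ [f]) (G ++ H) where
  flatten_old := by simp [h.flatten_old]
  flatten_new := by simp [h.flatten_new, hH]
  mem_edit := boundaryPrefixes_mono (List.prefix_append G H) h.mem_edit
  mem_left P hP hPA := by
    refine boundaryPrefixes_mono (List.prefix_append G H) ?_
    rcases mem_boundaryPrefixes_concat.1 hP with hP | rfl
    · exact h.mem_left P hP hPA
    · rw [hPA.eq_of_length_le (by simp [h.flatten_old])]
      exact h.mem_edit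
  mem_right R hR := by
    rcases mem_boundaryPrefixes_concat.1 hR with hR | hR
    · exact boundaryPrefixes_mono (List.prefix_append G H) (h.mem_right R hR)
    · rw [h.flatten_old, List.append_assoc _ w, List.append_cancel_left_eq] at hR
      exact ⟨G ++ H, List.prefix_rfl, by simp [h.flatten_new, hH, hR]⟩

theorem eq_nil_or_exists_of_suffix_append (hx : x.length ≤ 1) (h : s <:+ A ++ x) :
    s = [] ∨ ∃ u, u <:+ A ∧ s = u ++ x := by
  rcases (suffix_append_iff_or A x).1 h with h | h
  · rcases s.eq_nil_or_concat with rfl | ⟨t, a, rfl⟩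
    · exact .inl rfl
    · exact .inr ⟨[], List.nil_suffix, h.eq_of_length_le (hx.trans (by simp))⟩
  · exact .inr h

theorem prefix_or_exists_of_prefix_append (hx : x.length ≤ 1) (h : s <+: A ++ x ++ w) :
    s <+: A ∨ ∃ R, R <+: w ∧ s = A ++ x ++ R := by
  rcases (prefix_append_iff_or (A ++ x) w).1 h with h | h
  · rcases (prefix_append_iff_or A x).1 h with h | ⟨t, ht, rfl⟩
    · exact .inl h
    · rcases t with - | ⟨a, t⟩
      · exact .inl (by simp)
      · exact .inr ⟨[], List.nil_prefix, by simp [ht.eq_of_length_le (hx.trans (by simp))]⟩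
  · exact .inr h

/-- A source of `f` that ends left of the edited position is not affected. A source that ends right
of it can still be used unless it covers `x`, and then it covers a suffix of `A`. -/
theorem TransfersBoundaries.isEndPhrase_or_exists_crossing (h : TransfersBoundaries A x y w J G)
    (hx : x.length ≤ 1) (hf : IsEndPhrase J f) :
    IsEndPhrase G f ∨ ∃ u R, f = u ++ x ++ R ∧ u <:+ A ∧ R <+: w ∧
      IsEndPhrase G u ∧ IsEndPhrase G R := by
  rcases hf with h1 | ⟨P, hP, hs⟩
  · exact .inl (isEndPhrase_of_length_le_one h1)
  have hPw := prefix_flatten_of_mem_boundaryPrefixes hP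
  rw [h.flatten_old] at hPw
  rcases prefix_or_exists_of_prefix_append hx hPw with hPA | ⟨R, hR, rfl⟩
  · exact .inl (.inr ⟨P, h.mem_left P hP hPA, hs⟩)
  have hGR : ∀ {g}, g <:+ R → IsEndPhrase G g := fun hg =>
    .inr ⟨_, h.mem_right R hP, hg.trans (List.suffix_append (A ++ y) R)⟩
  rcases (suffix_append_iff_or (A ++ x) R).1 hs with hfR | ⟨s, hsA, rfl⟩
  · exact .inl (hGR hfR)
  rcases eq_nil_or_exists_of_suffix_append hx hsA with rfl | ⟨u, hu, rfl⟩
  · exact .inl (hGR List.suffix_rfl)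
  · exact .inr ⟨u, R, rfl, hu, hR, .inr ⟨A, h.mem_edit, hu⟩, hGR List.suffix_rfl⟩

/-- `G` is an LZ-End parsing that arises from `J` by cutting, for each `(u, R) ∈ D`, one phrase
`u ++ x ++ R` into `u`, `x` and `R`. These phrases are all different, as any further copy can use
the boundary of `G` behind the one that has been cut. -/
structure IsReparsing (A x y w : List α) (J G : List (List α))
    (D : Finset (List α × List α)) : Prop extends TransfersBoundaries A x y w J G where
  isEndParsing : IsEndParsing G
  crossing : ∀ p ∈ D, p.1 <:+ A ∧ p.2 <+: w ∧ IsEndPhrase G (p.1 ++ x ++ p.2)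
  length_le : G.length ≤ J.length + 2 * D.card
  sum_length_le : ∑ p ∈ D, (p.1.length + p.2.length) ≤ w.length

theorem isReparsing_concat_edit (hJ : IsEndParsing J) (hA : J.flatten = A) (x : List α)
    (hy : y.length ≤ 1) : IsReparsing A x y [] (J ++ [x]) (J ++ [y]) ∅ where
  toTransfersBoundaries := transfersBoundaries_concat_edit hA x y
  isEndParsing := isEndParsing_concat_iff.2 ⟨hJ, isEndPhrase_of_length_le_one hy⟩
  crossing := by simp
  length_le := by simp
  sum_length_le := by simp

theorem IsReparsing.concat (h : IsReparsing A x y w J G D) (hf : IsEndPhrase G f) :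
    IsReparsing A x y (w ++ f) (J ++ [f]) (G ++ [f]) D where
  toTransfersBoundaries := h.toTransfersBoundaries.concat (by simp)
  isEndParsing := isEndParsing_concat_iff.2 ⟨h.isEndParsing, hf⟩
  crossing p hp :=
    have ⟨hA, hw, hG⟩ := h.crossing p hp
    ⟨hA, hw.trans (List.prefix_append w f), hG.append [f]⟩
  length_le := by
    have := h.length_le
    simp only [List.length_append, List.length_singleton]
    omega
  sum_length_le := h.sum_length_le.trans (by simp)

theorem IsReparsing.concat_crossing {u : List α} (h : IsReparsing A x y w J G D)
    (hx : x.length ≤ 1) (hu : u <:+ A) (hR : R <+: w) (hGu : IsEndPhrase G u)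
    (hGR : IsEndPhrase G R) (hD : (u, R) ∉ D) :
    IsReparsing A x y (w ++ (u ++ x ++ R)) (J ++ [u ++ x ++ R]) (G ++ [u, x, R])
      (D.cons (u, R) hD) where
  toTransfersBoundaries := h.toTransfersBoundaries.concat (by simp)
  isEndParsing := h.isEndParsing.append (by simp [hGu, hGR, isEndPhrase_of_length_le_one hx])
  crossing := by
    rw [Finset.forall_mem_cons]
    refine ⟨⟨hu, hR.trans (List.prefix_append w _), .inr ⟨_, ⟨_, List.prefix_rfl, rfl⟩, ?_⟩⟩,
      fun p hp => ?_⟩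
    · exact ⟨G.flatten, by simp⟩
    · obtain ⟨hA, hw, hG⟩ := h.crossing p hp
      exact ⟨hA, hw.trans (List.prefix_append w _), hG.append _⟩
  length_le := by
    have := h.length_le
    simp only [List.length_append, List.length_cons, List.length_nil, Finset.card_cons]
    omega
  sum_length_le := by
    have := h.sum_length_le
    simp only [Finset.sum_cons, List.length_append]
    omega

theorem IsReparsing.exists_concat (h : IsReparsing A x y w J G D) (hx : x.length ≤ 1)
    (hf : IsEndPhrase J f) : ∃ G' D', IsReparsing A x y (w ++ f) (J ++ [f]) G' D' := by
  rcases h.isEndPhrase_or_exists_crossing hx hf with hf | ⟨u, R, rfl, hu, hR, hGu, hGR⟩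
  · exact ⟨_, _, h.concat hf⟩
  · by_cases hD : (u, R) ∈ D
    · exact ⟨_, _, h.concat (h.crossing _ hD).2.2⟩
    · exact ⟨_, _, h.concat_crossing hx hu hR hGu hGR hD⟩

theorem IsReparsing.exists_append (h : IsReparsing A x y w J G D) (hx : x.length ≤ 1)
    (hJK : IsEndParsing (J ++ K)) :
    ∃ G' D', IsReparsing A x y (w ++ K.flatten) (J ++ K) G' D' := by
  induction K using List.reverseRecOn with
  | nil => exact ⟨G, D, by simpa using h⟩
  | append_singleton K f ih =>
    rw [← List.append_assoc, isEndParsing_concat_iff] at hJK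
    obtain ⟨G', D', h'⟩ := ih hJK.1
    simpa using h'.exists_concat hx hJK.2

theorem card_mul_le_of_injOn {ι : Type*} {D : Finset ι} {g : ι → ℕ × ℕ} (hg : Set.InjOn g D)
    (L : ℕ) : D.card * L ≤ L ^ 3 + ∑ i ∈ D, ((g i).1 + (g i).2) := by
  have hshort : {i ∈ D | (g i).1 < L ∧ (g i).2 < L}.card ≤ L * L := by
    have hmaps : ∀ i ∈ {i ∈ D | (g i).1 < L ∧ (g i).2 < L},
        g i ∈ Finset.range L ×ˢ Finset.range L := by simp
    simpa using Finset.card_le_card_of_injOn g hmaps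
      (hg.mono (Finset.coe_subset.2 (Finset.filter_subset _ D)))
  have hlong : {i ∈ D | ¬((g i).1 < L ∧ (g i).2 < L)}.card * L ≤
      ∑ i ∈ D, ((g i).1 + (g i).2) :=
    calc _ ≤ ∑ i ∈ D with ¬((g i).1 < L ∧ (g i).2 < L), ((g i).1 + (g i).2) := by
          rw [← smul_eq_mul]
          refine Finset.card_nsmul_le_sum _ _ _ fun i hi => ?_
          have := (Finset.mem_filter.1 hi).2
          omega
      _ ≤ _ := Finset.sum_le_sum_of_subset (Finset.filter_subset _ D)
  calc D.card * L
      = {i ∈ D | (g i).1 < L ∧ (g i).2 < L}.card * L +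
          {i ∈ D | ¬((g i).1 < L ∧ (g i).2 < L)}.card * L := by
        rw [← add_mul, Finset.card_filter_add_card_filter_not]
    _ ≤ L * L * L + ∑ i ∈ D, ((g i).1 + (g i).2) := add_le_add (Nat.mul_le_mul_right L hshort) hlong
    _ = L ^ 3 + ∑ i ∈ D, ((g i).1 + (g i).2) := by ring

theorem IsReparsing.card_mul_le (h : IsReparsing A x y w J G D) (L : ℕ) :
    D.card * L ≤ L ^ 3 + w.length := by
  have hinj : Set.InjOn (fun p : List α × List α => (p.1.length, p.2.length)) D := by
    rintro p hp q hq hpq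
    obtain ⟨hlen₁, hlen₂⟩ := Prod.ext_iff.1 hpq
    obtain ⟨hpA, hpw, -⟩ := h.crossing p hp
    obtain ⟨hqA, hqw, -⟩ := h.crossing q hq
    exact Prod.ext
      ((List.suffix_of_suffix_length_le hpA hqA hlen₁.le).eq_of_length hlen₁)
      ((List.prefix_of_prefix_length_le hpw hqw hlen₂.le).eq_of_length hlen₂)
  exact (card_mul_le_of_injOn hinj L).trans (by gcongr; exact h.sum_length_le)

theorem le_of_choose_two_le {r L : ℕ} (h : r.choose 2 ≤ L ^ 3) : r ≤ 2 * L ^ 2 + 1 := by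
  by_contra! hr
  have hmono : (2 * L ^ 2 + 2).choose 2 ≤ L ^ 3 := (Nat.choose_le_choose 2 hr).trans h
  have hchoose : (2 * L ^ 2 + 2).choose 2 = (L ^ 2 + 1) * (2 * L ^ 2 + 1) := by
    rw [Nat.choose_two_right]
    exact Nat.div_eq_of_eq_mul_left two_pos (by rw [Nat.add_sub_assoc one_le_two]; ring)
  rw [hchoose] at hmono
  zify at hmono
  nlinarith [sq_nonneg ((L : ℤ) ^ 2 - L)]

theorem lzEndOpt_edit_le {L : ℕ} (hL : 0 < L) (hn : (A ++ x ++ B).length ≤ L ^ 3)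
    (hx : x.length ≤ 1) (hy : y.length ≤ 1) :
    lzEndOpt (A ++ y ++ B) ≤ lzEndOpt (A ++ x ++ B) + 8 * L ^ 2 := by
  obtain ⟨F, hF, hflat, hlen⟩ := exists_isEndParsing_length_eq_lzEndOpt (A ++ x ++ B)
  obtain ⟨J, K, r, hJK, rfl, rfl, hr, hJKF⟩ := hF.exists_isolate hx hflat
  rw [List.append_cons] at hJK
  have hJ : IsEndParsing J := hJK.of_prefix ⟨[x] ++ K, by simp⟩
  obtain ⟨G, D, hG⟩ := (isReparsing_concat_edit hJ rfl x hy).exists_append hx hJK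
  rw [List.nil_append] at hG
  simp only [List.length_append] at hn
  have hr' : r ≤ 2 * L ^ 2 + 1 := le_of_choose_two_le (hr.trans (by omega))
  have hD : D.card ≤ 2 * L ^ 2 := by
    refine Nat.le_of_mul_le_mul_right ?_ hL
    calc D.card * L ≤ L ^ 3 + K.flatten.length := hG.card_mul_le L
      _ ≤ L ^ 3 + L ^ 3 := by omega
      _ = 2 * L ^ 2 * L := by ring
  have hL2 : 0 < L ^ 2 := pow_pos hL 2
  calc lzEndOpt (J.flatten ++ y ++ K.flatten) ≤ G.length :=
        hG.flatten_new ▸ hG.isEndParsing.lzEndOpt_le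
    _ ≤ (J ++ x :: K).length + 2 * D.card := by simpa using hG.length_le
    _ ≤ lzEndOpt (J.flatten ++ x ++ K.flatten) + 8 * L ^ 2 := by omega

end Edit

section Sensitivity

variable {e : EditType} {S T : List α}

theorem SingleEdit.exists_eq_append (h : SingleEdit e S T) :
    ∃ A x y B : List α, S = A ++ x ++ B ∧ T = A ++ y ++ B ∧ x.length ≤ 1 ∧ y.length ≤ 1 := by
  cases h with
  | sub u v a b => exact ⟨u, [a], [b], v, by simp⟩
  | ins u v b => exact ⟨u, [], [b], v, by simp⟩
  | del u v a => exact ⟨u, [a], [], v, by simp⟩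

theorem SingleEdit.map {g : α → β} (hg : Function.Injective g) (h : SingleEdit e S T) :
    SingleEdit e (S.map g) (T.map g) := by
  cases h with
  | sub u v a b hab => simpa using SingleEdit.sub (u.map g) (v.map g) (g a) (g b) (hg.ne hab)
  | ins u v b => simpa using SingleEdit.ins (u.map g) (v.map g) (g b)
  | del u v a => simpa using SingleEdit.del (u.map g) (v.map g) (g a)

theorem additiveSensitivity_le {c : List α → ℕ} {n d : ℕ}
    (h : ∀ T T', T.length = n → SingleEdit e T T' → c T' ≤ c T + d) :
    additiveSensitivity e c n ≤ d := by
  rcases (sensitivitySet e c n).eq_empty_or_nonempty with hempty | hne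
  · rw [additiveSensitivity, hempty, Int.csSup_empty]
    exact Int.natCast_nonneg d
  · refine csSup_le hne ?_
    rintro _ ⟨T, T', hT, hlen, hdist, rfl⟩
    have := h T T' hT ((editDist_eq_one_iff e T T').1 ⟨hT ▸ hlen, hdist⟩)
    omega

theorem SingleEdit.sub_le_additiveSensitivity (h : SingleEdit e S T) :
    (lzEndOpt T : ℤ) - lzEndOpt S ≤ additiveSensitivity e (lzEndOpt (α := α)) S.length := by
  obtain ⟨hlen, hdist⟩ := (editDist_eq_one_iff e S T).2 h
  have hmem : (lzEndOpt T : ℤ) - lzEndOpt S ∈ sensitivitySet e lzEndOpt S.length :=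
    ⟨S, T, rfl, hlen, hdist, rfl⟩
  exact (isGreatest_additiveSensitivity e S.length ⟨_, hmem⟩).2 hmem

end Sensitivity

section SeparatedBlocks

variable {G : List (List α)} {S V W X Y Z : List α} {d : α}

theorem infix_or_infix_of_infix_append_cons (h : S <:+: X ++ d :: Y) (hd : d ∉ S) :
    S <:+: X ∨ S <:+: Y := by
  have hprefix : ∀ {t}, t <+: d :: Y → d ∉ t → t = [] := fun ht hdt =>
    (List.prefix_cons_iff.1 ht).resolve_right fun ⟨t', h', _⟩ => hdt (by simp [h'])
  rcases List.infix_append_iff.1 h with h | h | ⟨s, t, rfl, hs, ht⟩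
  · exact .inl h
  · rcases List.infix_cons_iff.1 h with h | h
    · exact .inl (hprefix h hd ▸ List.nil_infix)
    · exact .inr h
  · rw [hprefix ht fun hdt => hd (List.mem_append_right s hdt), List.append_nil]
    exact .inl hs.isInfix

theorem exists_isEndParsing_append_cons_of_notMem (hd : d ∉ X) (S : List α) :
    ∃ G K, IsEndParsing (G ++ [d] :: K) ∧ K.flatten = S ∧ G.flatten = X ∧
      lzEndOpt X + 1 + K.length ≤ lzEndOpt (X ++ d :: S) := by
  obtain ⟨F, hF, hflat, hlen⟩ := exists_isEndParsing_length_eq_lzEndOpt (X ++ d :: S)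
  obtain ⟨G, K, rfl, rfl, hK⟩ := hF.exists_eq_append_singleton_cons hflat hd
  have hG : lzEndOpt G.flatten ≤ G.length := (hF.of_prefix (List.prefix_append G _)).lzEndOpt_le
  refine ⟨G, K, hF, hK, rfl, ?_⟩
  rw [← hlen, List.length_append, List.length_cons]
  omega

theorem lzEndOpt_add_length_le_of_nodup (hZ : Z.Nodup) (hXZ : X.Disjoint Z) :
    lzEndOpt X + Z.length ≤ lzEndOpt (X ++ Z) := by
  induction Z using List.reverseRecOn with
  | nil => simp
  | append_singleton Z d ih =>
    rw [List.disjoint_append_right, List.disjoint_singleton] at hXZ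
    obtain ⟨hZ, -, hdZ⟩ := List.nodup_append.1 hZ
    have hd : d ∉ X ++ Z := by
      rw [List.mem_append, not_or]
      exact ⟨hXZ.2, fun h => hdZ d h d (List.mem_singleton_self d) rfl⟩
    obtain ⟨-, K, -, -, -, hle⟩ := exists_isEndParsing_append_cons_of_notMem hd []
    rw [List.append_assoc] at hle
    rw [List.length_append, List.length_singleton]
    have := ih hZ hXZ.1
    omega

/-- The fresh character `d` is a phrase, and `S` cannot be a single phrase after it. -/
theorem lzEndOpt_add_three_le (hdX : d ∉ X) (hdS : d ∉ S) (hS : 2 ≤ S.length)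
    (hSX : ¬ S <:+: X) : lzEndOpt X + 3 ≤ lzEndOpt (X ++ d :: S) := by
  obtain ⟨G, K, hGK, rfl, rfl, hle⟩ := exists_isEndParsing_append_cons_of_notMem hdX S
  suffices 2 ≤ K.length by omega
  by_contra! hK
  match K, hK with
  | [], _ => simp at hS
  | [f], _ =>
    rw [List.flatten_singleton] at hdS hS hSX
    rw [List.append_cons, isEndParsing_concat_iff] at hGK
    rcases hGK.2 with h1 | ⟨P, hP, hs⟩
    · omega
    · have hinfix : f <:+: G.flatten ++ [d] := by
        simpa using hs.isInfix.trans (prefix_flatten_of_mem_boundaryPrefixes hP).isInfix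
      rcases infix_or_infix_of_infix_append_cons hinfix hdS with h | h
      · exact hSX h
      · simp [List.infix_nil.1 h] at hS

theorem lzEndOpt_append_flatten_le (hG : ∀ g ∈ G, g.length ≤ 1 ∨ g <:+: W) :
    lzEndOpt (W ++ G.flatten) ≤ W.length + G.length := by
  have hphrase : ∀ g ∈ G, IsEndPhrase (W.map fun a => [a]) g := by
    refine fun g hg => (hG g hg).imp_right fun hgW => ?_
    obtain ⟨P, hgP, hPW⟩ := List.infix_iff_suffix_prefix.1 hgW
    exact ⟨P, ⟨_, hPW.map _, flatten_map_singleton P⟩, hgP⟩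
  have hW : IsEndParsing (W.map fun a => [a]) := isEndParsing_nil.append_map_singleton W
  simpa [flatten_map_singleton] using (hW.append hphrase).lzEndOpt_le

/-- The string `c 0, B 0, c 1, B 1, …` with `K` blocks. The characters `c k` serve as separators:
each of them is a phrase of its own. -/
def separatedBlocks (c : ℕ → α) (B : ℕ → List α) (K : ℕ) : List α :=
  (List.range K).flatMap fun k => c k :: B k

variable {c : ℕ → α} {B : ℕ → List α}

theorem append_separatedBlocks_succ (W : List α) (c : ℕ → α) (B : ℕ → List α) (K : ℕ) :
    W ++ separatedBlocks c B (K + 1) = (W ++ separatedBlocks c B K) ++ c K :: B K := by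
  simp [separatedBlocks, List.range_succ]

theorem mem_separatedBlocks {K : ℕ} :
    d ∈ separatedBlocks c B K ↔ ∃ k < K, d = c k ∨ d ∈ B k := by
  simp [separatedBlocks]

theorem length_separatedBlocks_le {l K : ℕ} (h : ∀ k < K, (B k).length ≤ l) :
    (separatedBlocks c B K).length ≤ K * (l + 1) := by
  rw [separatedBlocks, List.length_flatMap]
  refine (List.sum_le_card_nsmul _ (l + 1) ?_).trans (by simp)
  simpa using h

theorem not_infix_append_separatedBlocks {K : ℕ} (hc : ∀ k < K, c k ∉ V) (hW : ¬ V <:+: W)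
    (hB : ∀ k < K, ¬ V <:+: B k) : ¬ V <:+: W ++ separatedBlocks c B K := by
  induction K with
  | zero => simpa [separatedBlocks] using hW
  | succ K ih =>
    rw [append_separatedBlocks_succ]
    intro h
    rcases infix_or_infix_of_infix_append_cons h (hc K K.lt_succ_self) with h | h
    · exact ih (fun k hk => hc k (hk.trans K.lt_succ_self))
        (fun k hk => hB k (hk.trans K.lt_succ_self)) h
    · exact hB K K.lt_succ_self h

theorem lzEndOpt_append_separatedBlocks_le {K : ℕ} (hB : ∀ k < K, B k <:+: W) :
    lzEndOpt (W ++ separatedBlocks c B K) ≤ W.length + 2 * K := by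
  have hG : ∀ g ∈ (List.range K).flatMap fun k => [[c k], B k], g.length ≤ 1 ∨ g <:+: W := by
    simp only [List.mem_flatMap, List.mem_range, List.mem_cons, List.not_mem_nil, or_false]
    rintro g ⟨k, hk, rfl | rfl⟩
    · exact .inl le_rfl
    · exact .inr (hB k hk)
  have hflat : ((List.range K).flatMap fun k => [[c k], B k]).flatten = separatedBlocks c B K := by
    simp [separatedBlocks, List.flatMap_def, List.flatten_flatten, Function.comp_def]
  have hle := lzEndOpt_append_flatten_le hG
  simpa [hflat, List.length_flatMap, mul_comm] using hle

theorem lzEndOpt_add_le_append_separatedBlocks (hc : Function.Injective c) (hcW : ∀ k, c k ∉ W)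
    (hcB : ∀ k j, c k ∉ B j) (hlen : ∀ k, 2 ≤ (B k).length) {K : ℕ}
    (hBW : ∀ k < K, ¬ B k <:+: W) (hBB : ∀ k < K, ∀ j < k, ¬ B k <:+: B j) :
    lzEndOpt W + 3 * K ≤ lzEndOpt (W ++ separatedBlocks c B K) := by
  induction K with
  | zero => simp [separatedBlocks]
  | succ K ih =>
    have hfresh : c K ∉ W ++ separatedBlocks c B K := by
      rw [List.mem_append, mem_separatedBlocks]
      rintro (h | ⟨k, hk, h | h⟩)
      · exact hcW K h
      · exact hk.ne' (hc h)
      · exact hcB K k h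
    have hnew : ¬ B K <:+: W ++ separatedBlocks c B K :=
      not_infix_append_separatedBlocks (fun k _ => hcB k K) (hBW K K.lt_succ_self)
        (hBB K K.lt_succ_self)
    have hstep := lzEndOpt_add_three_le hfresh (hcB K K) (hlen K) hnew
    have hK := ih (fun k hk => hBW k (hk.trans K.lt_succ_self))
      fun k hk => hBB k (hk.trans K.lt_succ_self)
    rw [append_separatedBlocks_succ]
    omega

end SeparatedBlocks

section HardStrings

/-- The characters of the strings for the lower bound: two families of flanking characters,
separators, and characters for the edited middle part. -/
inductive Letter
  | left (i : ℕ)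
  | right (i : ℕ)
  | sep (k : ℕ)
  | mid (b : Bool)
  deriving Countable

variable {i i' j j' m n : ℕ} {x y z : List Bool}

/-- The string `left (i - 1) ⋯ left 0`. -/
def leftWord (i : ℕ) : List Letter :=
  ((List.range i).map Letter.left).reverse

/-- The string `right 0 ⋯ right (j - 1)`. -/
def rightWord (j : ℕ) : List Letter :=
  (List.range j).map Letter.right

/-- The middle part `z` with `i` characters to the left and `j` characters to the right of it. -/
def spanWord (z : List Bool) (i j : ℕ) : List Letter :=
  leftWord i ++ (z.map Letter.mid ++ rightWord j)

theorem leftWord_suffix_leftWord (h : i ≤ i') : leftWord i <:+ leftWord i' := by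
  obtain ⟨d, rfl⟩ := Nat.exists_eq_add_of_le h
  simp [leftWord, List.range_add]

theorem rightWord_prefix_rightWord (h : j ≤ j') : rightWord j <+: rightWord j' := by
  obtain ⟨d, rfl⟩ := Nat.exists_eq_add_of_le h
  simp [rightWord, List.range_add]

theorem spanWord_infix_spanWord (z : List Bool) (hi : i ≤ i') (hj : j ≤ j') :
    spanWord z i j <:+: spanWord z i' j' := by
  obtain ⟨s, hs⟩ := leftWord_suffix_leftWord hi
  obtain ⟨t, ht⟩ := rightWord_prefix_rightWord hj
  exact ⟨s, t, by simp [spanWord, ← hs, ← ht]⟩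

theorem left_mem_spanWord {t : ℕ} : Letter.left t ∈ spanWord z i j ↔ t < i := by
  simp [spanWord, leftWord, rightWord]

theorem right_mem_spanWord {t : ℕ} : Letter.right t ∈ spanWord z i j ↔ t < j := by
  simp [spanWord, leftWord, rightWord]

theorem sep_notMem_spanWord (k : ℕ) : Letter.sep k ∉ spanWord z i j := by
  simp [spanWord, leftWord, rightWord]

theorem le_of_spanWord_infix_spanWord (h : spanWord x i j <:+: spanWord y i' j') :
    i ≤ i' ∧ j ≤ j' :=
  ⟨le_of_forall_lt fun _ ht => left_mem_spanWord.1 (h.subset (left_mem_spanWord.2 ht)),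
    le_of_forall_lt fun _ ht => right_mem_spanWord.1 (h.subset (right_mem_spanWord.2 ht))⟩

theorem spanWord_succ (z : List Bool) (i j : ℕ) :
    spanWord z (i + 1) (j + 1) =
      ((List.range i).map fun t => Letter.left (t + 1)).reverse ++
        Letter.left 0 :: (z.map Letter.mid ++
          Letter.right 0 :: (List.range j).map fun t => Letter.right (t + 1)) := by
  simp [spanWord, leftWord, rightWord, List.range_succ_eq_map, Function.comp_def]

/-- The middle part can be read off between the unique occurrences of `left 0` and `right 0`. -/
theorem eq_of_spanWord_succ_infix_spanWord (h : spanWord x (i + 1) (j + 1) <:+: spanWord y i' j') :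
    x = y := by
  obtain ⟨hi, hj⟩ := le_of_spanWord_infix_spanWord h
  obtain ⟨i', rfl⟩ := Nat.exists_eq_add_of_le' (Nat.le_of_add_left_le hi)
  obtain ⟨j', rfl⟩ := Nat.exists_eq_add_of_le' (Nat.le_of_add_left_le hj)
  obtain ⟨s, t, hst⟩ := h
  simp only [spanWord_succ, List.append_assoc, List.cons_append] at hst
  rw [← List.append_assoc] at hst
  obtain ⟨-, -, hmid⟩ := (List.append_cons_inj_of_notMem (by simp) (by simp)).1 hst.symm
  obtain ⟨hyx, -, -⟩ := (List.append_cons_inj_of_notMem (by simp) (by simp)).1 hmid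
  exact (List.map_injective_iff.2 (fun _ _ => Letter.mid.inj) hyx).symm

theorem length_spanWord (z : List Bool) (i j : ℕ) :
    (spanWord z i j).length = i + z.length + j := by
  simp [spanWord, leftWord, rightWord, add_assoc]

theorem nodup_spanWord (hz : z.Nodup) (i j : ℕ) : (spanWord z i j).Nodup := by
  have hleft : (leftWord i).Nodup :=
    List.nodup_reverse.2 (List.nodup_range.map fun _ _ => Letter.left.inj)
  have hmid : (z.map Letter.mid).Nodup := hz.map fun _ _ => Letter.mid.inj
  have hright : (rightWord j).Nodup := List.nodup_range.map fun _ _ => Letter.right.inj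
  refine hleft.append (hmid.append hright ?_) ?_
  · simp [List.disjoint_right, rightWord]
  · simp [List.disjoint_left, leftWord, rightWord]

/-- Spans of `x` whose left and right parts have all lengths between `1` and `m`, in such an order
that none of them contains a later one. -/
def spanBlocks (x : List Bool) (m : ℕ) : List Letter :=
  separatedBlocks Letter.sep (fun k => spanWord x (k / m + 1) (k % m + 1)) (m ^ 2)

/-- The string for the lower bound: the central word around `z`, followed by the spans of `x`. If
`z = x`, then they all occur in the central word, and if `z ≠ x`, then none of them does. The `N`
fresh characters at the end adjust the length. -/
def hardString (x z : List Bool) (m N : ℕ) : List Letter :=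
  spanWord z m m ++ spanBlocks x m ++ (List.range N).map fun t => Letter.sep (m ^ 2 + t)

theorem div_add_one_le_and_mod_add_one_le {k : ℕ} (hk : k < m ^ 2) :
    k / m + 1 ≤ m ∧ k % m + 1 ≤ m := by
  have hm : 0 < m := Nat.pos_of_ne_zero fun h => by simp [h] at hk
  exact ⟨Nat.div_lt_of_lt_mul (by rwa [← sq]), Nat.mod_lt k hm⟩

theorem lzEndOpt_hardString_self_le (x : List Bool) (m N : ℕ) :
    lzEndOpt (hardString x x m N) ≤ 2 * m + x.length + 2 * m ^ 2 + N := by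
  have hblocks : lzEndOpt (spanWord x m m ++ spanBlocks x m) ≤
      (spanWord x m m).length + 2 * m ^ 2 := by
    refine lzEndOpt_append_separatedBlocks_le fun k hk => ?_
    obtain ⟨hdiv, hmod⟩ := div_add_one_le_and_mod_add_one_le hk
    exact spanWord_infix_spanWord x hdiv hmod
  have htail := lzEndOpt_append_le_add_length (spanWord x m m ++ spanBlocks x m)
    ((List.range N).map fun t => Letter.sep (m ^ 2 + t))
  rw [length_spanWord] at hblocks
  rw [List.length_map, List.length_range] at htail
  rw [hardString]
  omega

theorem le_lzEndOpt_hardString (hy : y.Nodup) (hxy : x ≠ y) (m N : ℕ) :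
    2 * m + y.length + 3 * m ^ 2 + N ≤ lzEndOpt (hardString x y m N) := by
  have hcentral : (spanWord y m m).length ≤ lzEndOpt (spanWord y m m) := by
    have h := lzEndOpt_add_length_le_of_nodup (nodup_spanWord hy m m) (List.disjoint_nil_left _)
    rw [List.nil_append] at h
    exact (Nat.le_add_left _ _).trans h
  have hblocks : lzEndOpt (spanWord y m m) + 3 * m ^ 2 ≤
      lzEndOpt (spanWord y m m ++ spanBlocks x m) := by
    refine lzEndOpt_add_le_append_separatedBlocks (fun _ _ => Letter.sep.inj) sep_notMem_spanWord
      (fun k j => sep_notMem_spanWord k) (fun k => ?_) (fun k _ h => ?_) (fun k _ j hj h => ?_)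
    · rw [length_spanWord]
      exact Nat.add_le_add (Nat.le_add_right_of_le (Nat.le_add_left 1 _)) (Nat.le_add_left 1 _)
    · exact hxy (eq_of_spanWord_succ_infix_spanWord h)
    · obtain ⟨hdiv, hmod⟩ := le_of_spanWord_infix_spanWord h
      refine hj.not_ge ?_
      rw [← Nat.div_add_mod k m, ← Nat.div_add_mod j m]
      exact add_le_add (Nat.mul_le_mul_left m (Nat.le_of_succ_le_succ hdiv))
        (Nat.le_of_succ_le_succ hmod)
  have hsep : ∀ t, Letter.sep (m ^ 2 + t) ∉ spanWord y m m ++ spanBlocks x m := by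
    intro t h
    rw [List.mem_append, spanBlocks, mem_separatedBlocks] at h
    rcases h with h | ⟨k, hk, h | h⟩
    · exact sep_notMem_spanWord _ h
    · have := Letter.sep.inj h
      omega
    · exact sep_notMem_spanWord _ h
  have hdisjoint : (spanWord y m m ++ spanBlocks x m).Disjoint
      ((List.range N).map fun t => Letter.sep (m ^ 2 + t)) := by
    rintro _ h htail
    obtain ⟨t, -, rfl⟩ := List.mem_map.1 htail
    exact hsep t h
  have htail := lzEndOpt_add_length_le_of_nodup
    (List.nodup_range.map fun _ _ h => Nat.add_left_cancel (Letter.sep.inj h)) hdisjoint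
  rw [length_spanWord] at hcentral
  rw [List.length_map, List.length_range] at htail
  rw [hardString]
  omega

theorem length_hardString_zero_le (hx : x.length ≤ 1) (hm : 0 < m) :
    (hardString x x m 0).length ≤ 8 * m ^ 3 := by
  have hblocks : (spanBlocks x m).length ≤ m ^ 2 * (2 * m + 1 + 1) := by
    refine length_separatedBlocks_le fun k hk => ?_
    obtain ⟨hdiv, hmod⟩ := div_add_one_le_and_mod_add_one_le hk
    rw [length_spanWord]
    omega
  calc (hardString x x m 0).length = m + x.length + m + (spanBlocks x m).length := by
        simp [hardString, length_spanWord]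
    _ ≤ m + 1 + m + m ^ 2 * (2 * m + 1 + 1) := by omega
    _ ≤ 8 * m ^ 3 := by nlinarith [Nat.one_le_pow 2 m hm, Nat.one_le_pow 3 m hm]

theorem length_hardString (x z : List Bool) (m N : ℕ) :
    (hardString x z m N).length = (hardString x z m 0).length + N := by
  simp [hardString, add_assoc]

theorem exists_hardString_eq_append (x : List Bool) (m N : ℕ) :
    ∃ u v, ∀ z, hardString x z m N = u ++ z.map Letter.mid ++ v :=
  ⟨leftWord m, rightWord m ++ spanBlocks x m ++ (List.range N).map fun t => Letter.sep (m ^ 2 + t),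
    fun z => by simp [hardString, spanWord]⟩

theorem exists_singleEdit_mid (e : EditType) :
    ∃ x y : List Bool, x ≠ y ∧ x.length ≤ 1 ∧ y.Nodup ∧
      ∀ u v, SingleEdit e (u ++ x.map Letter.mid ++ v) (u ++ y.map Letter.mid ++ v) := by
  cases e with
  | sub => exact ⟨[false], [true], by simp, by simp, by simp,
      fun u v => by simpa using SingleEdit.sub u v (Letter.mid false) (Letter.mid true) (by simp)⟩
  | ins => exact ⟨[], [true], by simp, by simp, by simp,
      fun u v => by simpa using SingleEdit.ins u v (Letter.mid true)⟩
  | del => exact ⟨[true], [], by simp, by simp, by simp,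
      fun u v => by simpa using SingleEdit.del u v (Letter.mid true)⟩

theorem exists_singleEdit_lzEndOpt_add_le (e : EditType) (hm : 0 < m) (hn : 8 * m ^ 3 ≤ n) :
    ∃ S T : List Letter, S.length = n ∧ SingleEdit e S T ∧
      lzEndOpt S + m ^ 2 ≤ lzEndOpt T + 1 := by
  obtain ⟨x, y, hxy, hx, hy, hedit⟩ := exists_singleEdit_mid e
  obtain ⟨N, hN⟩ := Nat.exists_eq_add_of_le ((length_hardString_zero_le hx hm).trans hn)
  refine ⟨hardString x x m N, hardString x y m N, ?_, ?_, ?_⟩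
  · rw [length_hardString, hN]
  · obtain ⟨u, v, huv⟩ := exists_hardString_eq_append x m N
    rw [huv, huv]
    exact hedit u v
  · have hold := lzEndOpt_hardString_self_le x m N
    have hnew := le_lzEndOpt_hardString hy hxy m N
    omega

end HardStrings

section TwoThirds

theorem exists_pow_three_eq_and_rpow_eq {x : ℝ} (hx : 0 ≤ x) :
    ∃ s, 0 ≤ s ∧ s ^ 3 = x ∧ x ^ (2 / 3 : ℝ) = s ^ 2 := by
  refine ⟨x ^ (1 / 3 : ℝ), by positivity, ?_, ?_⟩
  · rw [← Real.rpow_mul_natCast hx]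
    norm_num
  · rw [← Real.rpow_mul_natCast hx]
    norm_num

theorem additiveSensitivity_lzEndOpt_le (α : Type*) (e : EditType) {n : ℕ} (hn : 1 ≤ n) :
    (additiveSensitivity e (lzEndOpt (α := α)) n : ℝ) ≤ 32 * (n : ℝ) ^ (2 / 3 : ℝ) := by
  obtain ⟨s, hs, hsn, hpow⟩ := exists_pow_three_eq_and_rpow_eq n.cast_nonneg
  have hs1 : 1 ≤ s := by
    refine le_of_pow_le_pow_left₀ three_ne_zero hs ?_
    rw [one_pow, hsn]
    exact_mod_cast hn
  have hL : 0 < ⌈s⌉₊ := Nat.ceil_pos.2 (one_pos.trans_le hs1)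
  have hnL : n ≤ ⌈s⌉₊ ^ 3 := by
    have : (n : ℝ) ≤ (⌈s⌉₊ : ℝ) ^ 3 := hsn ▸ pow_le_pow_left₀ hs (Nat.le_ceil s) 3
    exact_mod_cast this
  have hceil : (⌈s⌉₊ : ℝ) ≤ 2 * s := by linarith [Nat.ceil_lt_add_one hs]
  have hsens : additiveSensitivity e (lzEndOpt (α := α)) n ≤ (8 * ⌈s⌉₊ ^ 2 : ℕ) := by
    refine additiveSensitivity_le fun S T hS hST => ?_
    obtain ⟨A, x, y, B, rfl, rfl, hx, hy⟩ := hST.exists_eq_append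
    exact lzEndOpt_edit_le hL (hS.trans_le hnL) hx hy
  calc (additiveSensitivity e (lzEndOpt (α := α)) n : ℝ) ≤ ((8 * ⌈s⌉₊ ^ 2 : ℕ) : ℝ) := by
        exact_mod_cast hsens
    _ = 8 * (⌈s⌉₊ : ℝ) ^ 2 := by push_cast; rfl
    _ ≤ 8 * (2 * s) ^ 2 := by gcongr
    _ = 32 * (n : ℝ) ^ (2 / 3 : ℝ) := by rw [hpow]; ring

theorem pow_two_sub_one_le_additiveSensitivity (α : Type*) [Infinite α] (e : EditType) {m n : ℕ}
    (hm : 0 < m) (hn : 8 * m ^ 3 ≤ n) :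
    (m : ℤ) ^ 2 - 1 ≤ additiveSensitivity e (lzEndOpt (α := α)) n := by
  obtain ⟨S, T, rfl, hST, hle⟩ := exists_singleEdit_lzEndOpt_add_le e hm hn
  obtain ⟨f, hf⟩ := exists_injective_nat Letter
  have hg : Function.Injective (Infinite.natEmbedding α ∘ f) :=
    (Infinite.natEmbedding α).injective.comp hf
  have h := (hST.map hg).sub_le_additiveSensitivity
  rw [lzEndOpt_map_of_injective hg, lzEndOpt_map_of_injective hg, List.length_map] at h
  refine le_trans ?_ h
  zify at hle
  linarith

theorem le_additiveSensitivity_lzEndOpt (α : Type*) [Infinite α] (e : EditType) {n : ℕ}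
    (hn : 64 ≤ n) :
    1 / 32 * (n : ℝ) ^ (2 / 3 : ℝ) ≤ additiveSensitivity e (lzEndOpt (α := α)) n := by
  obtain ⟨s, hs, hsn, hpow⟩ := exists_pow_three_eq_and_rpow_eq n.cast_nonneg
  have hs4 : 4 ≤ s := by
    refine le_of_pow_le_pow_left₀ three_ne_zero hs ?_
    rw [hsn]
    exact_mod_cast (by norm_num : 4 ^ 3 = 64).trans_le hn
  have hm : 2 ≤ ⌊s / 2⌋₊ := Nat.le_floor (by push_cast; linarith)
  have hfloor : (⌊s / 2⌋₊ : ℝ) ≤ s / 2 := Nat.floor_le (by positivity)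
  have hlt : s / 2 < ⌊s / 2⌋₊ + 1 := Nat.lt_floor_add_one _
  have hmn : 8 * ⌊s / 2⌋₊ ^ 3 ≤ n := by
    have : 8 * (⌊s / 2⌋₊ : ℝ) ^ 3 ≤ (n : ℝ) :=
      calc 8 * (⌊s / 2⌋₊ : ℝ) ^ 3 ≤ 8 * (s / 2) ^ 3 := by gcongr
        _ = (n : ℝ) := by rw [← hsn]; ring
    exact_mod_cast this
  have hsens := pow_two_sub_one_le_additiveSensitivity α e (two_pos.trans_le hm) hmn
  have hm' : (2 : ℝ) ≤ ⌊s / 2⌋₊ := by exact_mod_cast hm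
  calc 1 / 32 * (n : ℝ) ^ (2 / 3 : ℝ) = 1 / 32 * s ^ 2 := by rw [hpow]
    _ ≤ (⌊s / 2⌋₊ : ℝ) ^ 2 - 1 := by nlinarith
    _ ≤ additiveSensitivity e (lzEndOpt (α := α)) n := by exact_mod_cast hsens

end TwoThirds

theorem mainTheorem5 :
    (∃ C : ℝ, ∀ (α : Type u) (e : EditType) (n : ℕ), 1 ≤ n →
      (additiveSensitivity e (lzEndOpt (α := α)) n : ℝ) ≤ C * (n : ℝ) ^ (2 / 3 : ℝ)) ∧
    (∃ c : ℝ, 0 < c ∧ ∃ N : ℕ, ∀ (α : Type u) [Infinite α] (e : EditType) (n : ℕ), N ≤ n →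
      c * (n : ℝ) ^ (2 / 3 : ℝ) ≤ (additiveSensitivity e (lzEndOpt (α := α)) n : ℝ)) :=
  ⟨⟨32, fun α e _ hn => additiveSensitivity_lzEndOpt_le α e hn⟩,
    1 / 32, by norm_num, 64, fun α _ e _ hn => le_additiveSensitivity_lzEndOpt α e hn⟩
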